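/- Let $N=2^n=LM$ with $n\ge 0$ and positive integers $L,M$, let $F_N=\begin{pmatrix}1&0\\1&1\end{pmatrix}^{\otimes n}$ over $\mathbb F_2$, let $i\in\{1,\dots,N\}$ and $E_s,N_0>0$. A uniformly distributed source block $u\in\{0,1\}^N$ is encoded as $x=uF_N$, and $x$ is split into $L$ consecutive blocks $x_1,\dots,x_L$ of length $M$ (block mapping). Entry $x_{l,k}$ is sent as $s_{l,k}=\sqrt{E_s}(1-2x_{l,k})$ and received as $y_{l,k}=\alpha_l s_{l,k}+z_{l,k}$, where the fading coefficients $\alpha_1,\dots,\alpha_L$ are Rayleigh distributed with $\mathbb E(\alpha_l^2)=1$, the noise samples $z_{l,k}$ are real Gaussian with mean $0$ and variance $N_0/2$, and the source block, all fading coefficients and all noise samples are independent. With $W_N(y\mid x,\alpha)$ the conditional density of $y=(y_{l,k})$ given $x$ and $\alpha=(\alpha_l)$, the polarized channel $W_N^{(i)}$ has input $u_i$, output $(y,u_1^{i-1})$ and, given $\alpha$, transition density $$W_N^{(i)}(y,u_1^{i-1}\mid u_i,\alpha)=\frac1{2^{N-1}}\sum_{u_{i+1},\dots,u_N\in\{0,1\}}W_N(y\mid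 uF_N,\alpha).$$ Its error probability $P(W_N^{(i)})$ is the probability that the maximum likelihood decision on $u_i$ from $(y,u_1^{i-1})$ and $\alpha$ (known to the receiver) differs from $u_i$. Let $\mathbb D_N^{(i)}=\{(0,\dots,0,1,u_{i+1},\dots,u_N)F_N : u_{i+1},\dots,u_N\in\{0,1\}\}$ be the $i$-th polar subcode (with the entry $1$ in position $i$), let $d_{\min}^{(i)}$ be the minimum Hamming weight of its codewords, and for $\mathbf d=(d_1,\dots,d_L)$ let $A_N^{(i)}(\mathbf d)$ be the number of codewords in $\mathbb D_N^{(i)}$ whose $l$-th block has Hamming weight $d_l$ for every $l=1,\dots,L$. Then $$P\big(W_N^{(i)}\big)\le\sum_{\substack{\mathbf d\in\{0,1,\dots,M\}^L\\ d_{\min}^{(i)}\le d_1+\dots+d_L\le N}}A_N^{(i)}(\mathbf d)\prod_{l=1}^L\frac{1}{d_l\,E_s/N_0+1}.$$ -/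

import Mathlib

open scoped Kronecker

noncomputable section

namespace PolarFading

/-- The `2 × 2` polarization kernel over the field with two elements. -/
def kernelF2 : Matrix (Fin 2) (Fin 2) (ZMod 2) := !![1, 0; 1, 1]

/-- The polar generator matrix `F_N`, `N = 2 ^ n`: the `n`-th Kronecker power of the kernel. -/
def polarMatrix : (n : ℕ) → Matrix (Fin (2 ^ n)) (Fin (2 ^ n)) (ZMod 2)
  | 0 => 1
  | n + 1 =>
      let e : Fin 2 × Fin (2 ^ n) ≃ Fin (2 ^ (n + 1)) :=
        finProdFinEquiv.trans (finCongr (pow_succ' 2 n).symm)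
      Matrix.reindex e e (kernelF2 ⊗ₖ polarMatrix n)

/-- The codeword `u F_N` of the source block `u`. -/
def encode (n : ℕ) (u : Fin (2 ^ n) → ZMod 2) : Fin (2 ^ n) → ZMod 2 :=
  Matrix.vecMul u (polarMatrix n)

/-- The polar subcode: codewords of source blocks `(0, …, 0, 1, u_{i+1}, …, u_N)`,
with the entry `1` in position `i`. -/
def polarSubcode (n : ℕ) (i : Fin (2 ^ n)) : Set (Fin (2 ^ n) → ZMod 2) :=
  {c | ∃ u : Fin (2 ^ n) → ZMod 2, (∀ j < i, u j = 0) ∧ u i = 1 ∧ c = encode n u}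

/-- The minimum Hamming distance from the all-zero word to the polar subcode,
that is, the least weight of its codewords. -/
def minDist (n : ℕ) (i : Fin (2 ^ n)) : ℕ :=
  sInf (hammingNorm '' polarSubcode n i)

/-- The `l`-th of `L` consecutive blocks of length `M` of a vector of length `2 ^ n = L * M`:
entry `k` of block `l` is entry `l * M + k` of the vector (counting from `0`). -/
def block {n L M : ℕ} (h : L * M = 2 ^ n) (c : Fin (2 ^ n) → ZMod 2) (l : Fin L) :
    Fin M → ZMod 2 :=
  fun k => c (finCongr h (finProdFinEquiv (l, k)))

/-- The split polar weight enumerator: the number of codewords of the polar subcode whose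
`l`-th block has Hamming weight `d l` for every `l`. -/
def splitEnumerator {n L M : ℕ} (h : L * M = 2 ^ n) (i : Fin (2 ^ n)) (d : Fin L → ℕ) : ℕ :=
  Set.ncard {c ∈ polarSubcode n i | ∀ l, hammingNorm (block h c l) = d l}

/-- The BPSK symbol `√Es (1 - 2 x)` of a bit `x`. -/
def bpsk (Es : ℝ) (x : ZMod 2) : ℝ := √Es * (1 - 2 * (x.val : ℝ))

/-- The received blocks `y_l = α_l s_l + z_l` when the codeword `c` is sent with block mapping,
for fading coefficients `α` and noise `z`. -/
def received {n L M : ℕ} (h : L * M = 2 ^ n) (Es : ℝ) (c : Fin (2 ^ n) → ZMod 2)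
    (α : Fin L → ℝ) (z : Fin L → Fin M → ℝ) : Fin L → Fin M → ℝ :=
  fun l k => α l * bpsk Es (block h c l k) + z l k

/-- The transition density `W_N(y | x, α)` of the block fading channel. -/
def channelDensity {n L M : ℕ} (h : L * M = 2 ^ n) (Es N0 : ℝ) (y : Fin L → Fin M → ℝ)
    (x : Fin (2 ^ n) → ZMod 2) (α : Fin L → ℝ) : ℝ :=
  1 / (Real.pi * N0) ^ (((2 ^ n : ℕ) : ℝ) / 2) *
    ∏ l, ∏ m, Real.exp (-(y l m - α l * bpsk Es (block h x l m)) ^ 2 / N0)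

open Classical in
/-- The transition density `W_N^{(i)}(y, u_1^{i-1} | u_i, α)` of the `i`-th polarized channel,
with input `b = u_i` and output `(y, v)`, `v = u_1^{i-1}`. -/
def polarizedDensity {n L M : ℕ} (h : L * M = 2 ^ n) (Es N0 : ℝ) (i : Fin (2 ^ n))
    (y : Fin L → Fin M → ℝ) (v : {j : Fin (2 ^ n) // j < i} → ZMod 2) (b : ZMod 2)
    (α : Fin L → ℝ) : ℝ :=
  1 / 2 ^ (2 ^ n - 1) *
    ∑ u : Fin (2 ^ n) → ZMod 2 with (∀ j : {j // j < i}, u j = v j) ∧ u i = b,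
      channelDensity h Es N0 y (encode n u) α

open Classical in
/-- The maximum likelihood decision on the input of the `i`-th polarized channel, from its output
`(y, v)` and the fading coefficients, which the receiver knows. -/
def mlDecision {n L M : ℕ} (h : L * M = 2 ^ n) (Es N0 : ℝ) (i : Fin (2 ^ n))
    (y : Fin L → Fin M → ℝ) (v : {j : Fin (2 ^ n) // j < i} → ZMod 2) (α : Fin L → ℝ) : ZMod 2 :=
  if polarizedDensity h Es N0 i y v 1 α ≤ polarizedDensity h Es N0 i y v 0 α then 0 else 1

/-- The Rayleigh distribution with parameter `σ`. -/
def rayleigh (σ : ℝ) : MeasureTheory.Measure ℝ :=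
  MeasureTheory.volume.withDensity fun a =>
    ENNReal.ofReal (if 0 ≤ a then a / σ ^ 2 * Real.exp (-a ^ 2 / (2 * σ ^ 2)) else 0)

/-- The joint law of fading and noise: independent Rayleigh coefficients, one per block, of second
moment `2 σ ^ 2 = 1`, and, independent of them, independent real Gaussian noise samples of mean `0`
and variance `N0 / 2`. -/
def fadingNoise (L M : ℕ) (N0 : ℝ) :
    MeasureTheory.Measure ((Fin L → ℝ) × (Fin L → Fin M → ℝ)) :=
  (MeasureTheory.Measure.pi fun _ => rayleigh √(1 / 2)).prod
    (MeasureTheory.Measure.pi fun _ => MeasureTheory.Measure.pi fun _ =>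
      ProbabilityTheory.gaussianReal 0 (N0 / 2).toNNReal)

/-- The error probability of the `i`-th polarized channel on the block Rayleigh fading channel:
the probability that the maximum likelihood decision from `(y, u_1^{i-1})` and `α` differs from
`u_i`, for a uniformly distributed source block `u` independent of fading and noise. -/
def polarizedErrorProb {n L M : ℕ} (h : L * M = 2 ^ n) (Es N0 : ℝ) (i : Fin (2 ^ n)) : ℝ :=
  1 / 2 ^ (2 ^ n) * ∑ u : Fin (2 ^ n) → ZMod 2,
    (fadingNoise L M N0).real
      {ω | mlDecision h Es N0 i (received h Es (encode n u) ω.1 ω.2) (fun j => u j) ω.1 ≠ u i}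

end PolarFading

end

open MeasureTheory ProbabilityTheory

namespace PolarFading

/-! This is a Bhattacharyya union bound. Fix the source block `u`. If the decision on `u i` fails,
the likelihoods of all competitors (same past, opposite bit) sum to at least that of `u`, so their
likelihood ratios sum to at least 1. The square roots then also sum to at least 1, and Markov's
inequality bounds the error probability by the sum of their means (`errorProb_given_source_le`).

Each mean factors over the blocks. A Gaussian average turns a block with `d` differing bits into
`exp (-d α² Es / N0)`, and the Rayleigh average of this is `1 / (d Es / N0 + 1)`
(`lintegral_sqrtRatio`). By linearity the differences to the competitors are exactly the subcode
(`sum_competitors`), whatever `u` is; grouping them by block weights gives the enumerator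
(`sum_fadingFactor_eq`). -/

theorem lintegral_pi_fin_prod {k : ℕ} {E : Type*} [MeasurableSpace E] (μ : Measure E)
    [SigmaFinite μ] (f : Fin k → E → ENNReal) (hf : ∀ i, Measurable (f i)) :
    ∫⁻ x, ∏ i, f i (x i) ∂(Measure.pi fun _ : Fin k => μ) = ∏ i, ∫⁻ x, f i x ∂μ := by
  induction k with
  | zero => simp
  | succ k ih =>
    have hmp := (measurePreserving_piFinSuccAbove (fun _ : Fin (k + 1) => μ) 0).symm
    rw [← hmp.lintegral_comp_emb (MeasurableEquiv.measurableEmbedding _)]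
    simp only [MeasurableEquiv.piFinSuccAbove_symm_apply, Fin.insertNthEquiv,
      Fin.prod_univ_succ, Fin.insertNth_zero, Equiv.coe_fn_mk, Fin.cons_succ, Fin.cons_zero]
    rw [← ih (fun i => f i.succ) (fun i => hf _)]
    exact lintegral_prod_mul (hf 0).aemeasurable
      (Finset.measurable_prod _ fun i _ => (hf _).comp (measurable_pi_apply i)).aemeasurable

/-! ### Codewords, block weights and competitors -/

theorem det_polarMatrix (n : ℕ) : (polarMatrix n).det = 1 := by
  induction n with
  | zero => simp [polarMatrix]
  | succ n ih =>
    rw [polarMatrix, Matrix.det_reindex_self, Matrix.det_kronecker, ih]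
    simp [kernelF2, Matrix.det_fin_two]

theorem encode_injective (n : ℕ) : Function.Injective (encode n) := by
  refine Matrix.vecMul_injective_of_isUnit ?_
  rw [Matrix.isUnit_iff_isUnit_det, det_polarMatrix]
  exact isUnit_one

theorem encode_sub (n : ℕ) (u v : Fin (2 ^ n) → ZMod 2) :
    encode n (u - v) = encode n u - encode n v :=
  Matrix.sub_vecMul _ _ _

/-- The split of a word into `L` blocks adds up to its Hamming weight. -/
theorem sum_hammingNorm_block {n L M : ℕ} (h : L * M = 2 ^ n) (c : Fin (2 ^ n) → ZMod 2) :
    ∑ l, hammingNorm (block h c l) = hammingNorm c := by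
  simp only [hammingNorm, Finset.card_filter]
  rw [← Fintype.sum_prod_type' (f := fun l k => if block h c l k ≠ 0 then 1 else 0)]
  exact (finProdFinEquiv.trans (finCongr h)).sum_comp (fun j => if c j ≠ 0 then 1 else 0)

/-- The product over the blocks of the averaged Bhattacharyya factors of a word. -/
noncomputable def fadingFactor {n L M : ℕ} (h : L * M = 2 ^ n) (r : ℝ) (c : Fin (2 ^ n) → ZMod 2) : ℝ :=
  ∏ l, 1 / ((hammingNorm (block h c l) : ℝ) * r + 1)

theorem fadingFactor_nonneg {n L M : ℕ} (h : L * M = 2 ^ n) {r : ℝ} (hr : 0 ≤ r)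
    (c : Fin (2 ^ n) → ZMod 2) : 0 ≤ fadingFactor h r c :=
  Finset.prod_nonneg fun _ _ => by positivity

open Classical in
theorem sum_fadingFactor_eq {n L M : ℕ} (h : L * M = 2 ^ n) (i : Fin (2 ^ n)) (r : ℝ) :
    ∑ c : Fin (2 ^ n) → ZMod 2 with c ∈ polarSubcode n i, fadingFactor h r c =
      ∑ d ∈ Fintype.piFinset (fun _ : Fin L => Finset.Icc 0 M) with
          minDist n i ≤ ∑ l, d l ∧ ∑ l, d l ≤ 2 ^ n,
        (splitEnumerator h i d : ℝ) * ∏ l, 1 / ((d l : ℝ) * r + 1) := by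
  rw [← Finset.sum_fiberwise_of_maps_to (g := fun c l => hammingNorm (block h c l))
    (t := (Fintype.piFinset (fun _ : Fin L => Finset.Icc 0 M)).filter fun d =>
      minDist n i ≤ ∑ l, d l ∧ ∑ l, d l ≤ 2 ^ n)]
  · refine Finset.sum_congr rfl fun d _ => ?_
    have hcard : splitEnumerator h i d = Finset.card {c ∈ Finset.univ.filter
        (fun c : Fin (2 ^ n) → ZMod 2 => c ∈ polarSubcode n i) |
          (fun l => hammingNorm (block h c l)) = d} := by
      rw [splitEnumerator, ← Set.ncard_coe_finset]
      congr 1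
      ext c
      simp [funext_iff]
    rw [hcard, ← nsmul_eq_mul]
    refine Finset.sum_eq_card_nsmul fun c hc => ?_
    rw [← (Finset.mem_filter.1 hc).2]
    rfl
  · intro c hc
    have hc := (Finset.mem_filter.1 hc).2
    simp only [Finset.mem_filter, Fintype.mem_piFinset, Finset.mem_Icc, zero_le, true_and,
      sum_hammingNorm_block]
    refine ⟨fun l => ?_, Nat.sInf_le ⟨c, hc, rfl⟩, ?_⟩
    · simpa using hammingNorm_le_card_fintype (x := block h c l)
    · simpa using hammingNorm_le_card_fintype (x := c)

/-- The source blocks that agree with `u` before position `i` and differ from it at `i`. -/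
def competitors {n : ℕ} (i : Fin (2 ^ n)) (u : Fin (2 ^ n) → ZMod 2) :
    Finset (Fin (2 ^ n) → ZMod 2) :=
  {w | (∀ j < i, w j = u j) ∧ w i = u i + 1}

open Classical in
-- Subtracting the codeword of `u` leaves source blocks that vanish before `i` and equal 1 at `i`;
-- as the encoder is injective, no codeword is counted twice.
theorem sum_competitors {n : ℕ} (i : Fin (2 ^ n)) (u : Fin (2 ^ n) → ZMod 2)
    (f : (Fin (2 ^ n) → ZMod 2) → ℝ) :
    ∑ w ∈ competitors i u, f (encode n w - encode n u) =
      ∑ c : Fin (2 ^ n) → ZMod 2 with c ∈ polarSubcode n i, f c := by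
  refine Finset.sum_nbij (fun w => encode n w - encode n u) ?_ ?_ ?_ fun _ _ => rfl
  · intro w hw
    obtain ⟨h1, h2⟩ := (Finset.mem_filter.1 hw).2
    refine Finset.mem_filter.2 ⟨Finset.mem_univ _, w - u, fun j hj => ?_, ?_, ?_⟩
    · simp [h1 j hj]
    · simp [h2]
    · rw [encode_sub]
  · intro w _ w' _ hww
    exact encode_injective n (sub_left_injective hww)
  · intro c hc
    obtain ⟨v, h1, h2, rfl⟩ := (Finset.mem_filter.1 hc).2
    refine ⟨v + u, Finset.mem_filter.2 ⟨Finset.mem_univ _, fun j hj => ?_, ?_⟩, ?_⟩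
    · simp [h1 j hj]
    · simp [h2, add_comm]
    · simp [← encode_sub]

/-! ### Decision errors and likelihood ratios -/

/-- The tie-breaking rule is immaterial: a nonstrict inequality holds for either wrong decision. -/
theorem polarizedDensity_le_of_mlDecision_ne {n L M : ℕ} (h : L * M = 2 ^ n) (Es N0 : ℝ)
    (i : Fin (2 ^ n)) (y : Fin L → Fin M → ℝ) (v : {j : Fin (2 ^ n) // j < i} → ZMod 2)
    (α : Fin L → ℝ) (b : ZMod 2) (hne : mlDecision h Es N0 i y v α ≠ b) :
    polarizedDensity h Es N0 i y v b α ≤ polarizedDensity h Es N0 i y v (b + 1) α := by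
  unfold mlDecision at hne
  have h01 : ∀ c : ZMod 2, c = 0 ∨ c = 1 := by decide
  have h11 : (1 : ZMod 2) + 1 = 0 := by decide
  rcases h01 b with rfl | rfl <;> split_ifs at hne with hle
  · exact absurd rfl hne
  · rw [zero_add]; exact (not_le.1 hle).le
  · rwa [h11]
  · exact absurd rfl hne

theorem channelDensity_pos {n L M : ℕ} (h : L * M = 2 ^ n) (Es : ℝ) {N0 : ℝ} (hN0 : 0 < N0)
    (y : Fin L → Fin M → ℝ) (x : Fin (2 ^ n) → ZMod 2) (α : Fin L → ℝ) :
    0 < channelDensity h Es N0 y x α := by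
  have := Real.pi_pos
  exact mul_pos (by positivity)
    (Finset.prod_pos fun _ _ => Finset.prod_pos fun _ _ => Real.exp_pos _)

theorem channelDensity_le_sum_competitors {n L M : ℕ} (h : L * M = 2 ^ n) (Es : ℝ) {N0 : ℝ}
    (hN0 : 0 < N0) (i : Fin (2 ^ n)) (u : Fin (2 ^ n) → ZMod 2) (y : Fin L → Fin M → ℝ)
    (α : Fin L → ℝ) (hne : mlDecision h Es N0 i y (fun j => u j) α ≠ u i) :
    channelDensity h Es N0 y (encode n u) α ≤
      ∑ w ∈ competitors i u, channelDensity h Es N0 y (encode n w) α := by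
  classical
  have hle := polarizedDensity_le_of_mlDecision_ne h Es N0 i y _ α _ hne
  unfold polarizedDensity at hle
  have hle := le_of_mul_le_mul_left hle (by positivity)
  -- The block `u` is itself one term of the sum for its own bit.
  refine (Finset.single_le_sum (f := fun w => channelDensity h Es N0 y (encode n w) α)
    (fun w _ => (channelDensity_pos h Es hN0 y _ α).le) ?_).trans (hle.trans_eq ?_)
  · simp
  · refine Finset.sum_congr ?_ fun _ _ => rfl
    ext w
    simp [competitors]

/-- The square root of the likelihood ratio of the codewords `c'` and `c`, as a function of the
fading and the noise, when `c` is sent. -/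
noncomputable def sqrtRatio {n L M : ℕ} (h : L * M = 2 ^ n) (Es N0 : ℝ) (c c' : Fin (2 ^ n) → ZMod 2)
    (α : Fin L → ℝ) (z : Fin L → Fin M → ℝ) : ℝ :=
  ∏ l, ∏ m, Real.exp
    (-(α l * (bpsk Es (block h c l m) - bpsk Es (block h c' l m)) / N0) * z l m -
      (α l * (bpsk Es (block h c l m) - bpsk Es (block h c' l m))) ^ 2 / (2 * N0))

theorem sqrtRatio_pos {n L M : ℕ} (h : L * M = 2 ^ n) (Es N0 : ℝ) (c c' : Fin (2 ^ n) → ZMod 2)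
    (α : Fin L → ℝ) (z : Fin L → Fin M → ℝ) : 0 < sqrtRatio h Es N0 c c' α z :=
  Finset.prod_pos fun _ _ => Finset.prod_pos fun _ _ => Real.exp_pos _

/-- With `δ` the faded difference of two symbols, `z² - (z + δ)² = -2δz - δ²`; half of this over
`N0` is the exponent in `sqrtRatio`. -/
theorem channelDensity_received {n L M : ℕ} (h : L * M = 2 ^ n) (Es : ℝ) {N0 : ℝ}
    (hN0 : 0 < N0) (c c' : Fin (2 ^ n) → ZMod 2) (α : Fin L → ℝ) (z : Fin L → Fin M → ℝ) :
    channelDensity h Es N0 (received h Es c α z) c' α =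
      channelDensity h Es N0 (received h Es c α z) c α * sqrtRatio h Es N0 c c' α z ^ 2 := by
  unfold channelDensity sqrtRatio received
  rw [mul_assoc]
  congr 1
  simp only [← Finset.prod_pow, ← Finset.prod_mul_distrib]
  refine Finset.prod_congr rfl fun l _ => Finset.prod_congr rfl fun m _ => ?_
  rw [← Real.exp_nat_mul, ← Real.exp_add]
  congr 1
  field_simp
  push_cast
  ring

/-- If the sum were below 1, every term would be too, so squaring could only shrink the sum. -/
theorem one_le_sum_of_one_le_sum_sq {ι : Type*} (s : Finset ι) (f : ι → ℝ)
    (hf : ∀ i ∈ s, 0 ≤ f i) (h : 1 ≤ ∑ i ∈ s, f i ^ 2) : 1 ≤ ∑ i ∈ s, f i := by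
  by_contra! hlt
  have hle : ∀ i ∈ s, f i ^ 2 ≤ f i := fun i hi => by
    have := (Finset.single_le_sum hf hi).trans hlt.le
    nlinarith [hf i hi]
  linarith [Finset.sum_le_sum hle]

theorem one_le_sum_sqrtRatio {n L M : ℕ} (h : L * M = 2 ^ n) (Es : ℝ) {N0 : ℝ}
    (hN0 : 0 < N0) (i : Fin (2 ^ n)) (u : Fin (2 ^ n) → ZMod 2)
    (α : Fin L → ℝ) (z : Fin L → Fin M → ℝ)
    (hne : mlDecision h Es N0 i (received h Es (encode n u) α z) (fun j => u j) α ≠ u i) :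
    1 ≤ ∑ w ∈ competitors i u, sqrtRatio h Es N0 (encode n u) (encode n w) α z := by
  refine one_le_sum_of_one_le_sum_sq _ _ (fun w _ => (sqrtRatio_pos h Es N0 _ _ α z).le) ?_
  have hle := channelDensity_le_sum_competitors h Es hN0 i u _ α hne
  rw [Finset.sum_congr rfl fun w _ =>
    channelDensity_received h Es hN0 (encode n u) (encode n w) α z, ← Finset.mul_sum] at hle
  exact le_of_mul_le_mul_left (by simpa using hle)
    (channelDensity_pos h Es hN0 (received h Es (encode n u) α z) (encode n u) α)

/-! ### Averages over noise and fading -/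

theorem lintegral_exp_gaussianReal (t a : ℝ) (v : NNReal) :
    ∫⁻ x, ENNReal.ofReal (Real.exp (t * x - a)) ∂(gaussianReal 0 v) =
      ENNReal.ofReal (Real.exp (v * t ^ 2 / 2 - a)) := by
  have hmgf := congrFun (mgf_fun_id_gaussianReal (μ := 0) (v := v)) t
  rw [mgf] at hmgf
  simp only [Real.exp_sub, div_eq_mul_inv _ (Real.exp a)]
  rw [← ofReal_integral_eq_lintegral_ofReal
    ((integrable_exp_mul_gaussianReal t).mul_const _)
    (Filter.Eventually.of_forall fun x => by positivity), integral_mul_const, hmgf]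
  simp

theorem sq_bpsk_sub {Es : ℝ} (hEs : 0 ≤ Es) (a b : ZMod 2) :
    (bpsk Es a - bpsk Es b) ^ 2 = if b - a ≠ 0 then 4 * Es else 0 := by
  have hs := Real.sq_sqrt hEs
  have h01 : ∀ c : ZMod 2, c = 0 ∨ c = 1 := by decide
  rcases h01 a with rfl | rfl <;> rcases h01 b with rfl | rfl <;>
    simp [bpsk, ZMod.val_one] <;> linarith

theorem sum_sq_bpsk_sub {n L M : ℕ} (h : L * M = 2 ^ n) {Es : ℝ} (hEs : 0 ≤ Es)
    (c c' : Fin (2 ^ n) → ZMod 2) (l : Fin L) :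
    ∑ m, (bpsk Es (block h c l m) - bpsk Es (block h c' l m)) ^ 2 =
      4 * Es * hammingNorm (block h (c' - c) l) := by
  simp only [sq_bpsk_sub hEs, hammingNorm, Finset.card_filter, Nat.cast_sum, Finset.mul_sum]
  refine Finset.sum_congr rfl fun m _ => ?_
  have hb : block h (c' - c) l m = block h c' l m - block h c l m := rfl
  rw [hb]
  split_ifs <;> simp

instance (σ : ℝ) : SigmaFinite (rayleigh σ) := by
  unfold rayleigh
  infer_instance

theorem measurable_sqrtRatio {n L M : ℕ} (h : L * M = 2 ^ n) (Es N0 : ℝ)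
    (c c' : Fin (2 ^ n) → ZMod 2) :
    Measurable fun ω : (Fin L → ℝ) × (Fin L → Fin M → ℝ) =>
      sqrtRatio h Es N0 c c' ω.1 ω.2 := by
  unfold sqrtRatio
  fun_prop

theorem lintegral_noise_sqrtRatio {n L M : ℕ} (h : L * M = 2 ^ n) {Es N0 : ℝ} (hEs : 0 ≤ Es)
    (hN0 : 0 < N0) (c c' : Fin (2 ^ n) → ZMod 2) (α : Fin L → ℝ) :
    ∫⁻ z, ENNReal.ofReal (sqrtRatio h Es N0 c c' α z)
      ∂(Measure.pi fun _ : Fin L => Measure.pi fun _ : Fin M =>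
        gaussianReal 0 (N0 / 2).toNNReal) =
      ∏ l, ENNReal.ofReal
        (Real.exp (-(hammingNorm (block h (c' - c) l) * (Es / N0)) * α l ^ 2)) := by
  unfold sqrtRatio
  simp only [ENNReal.ofReal_prod_of_nonneg, Finset.prod_nonneg, Real.exp_nonneg, implies_true]
  rw [lintegral_pi_fin_prod (E := Fin M → ℝ) _
    (fun l zl => ∏ m, ENNReal.ofReal (Real.exp
      (-(α l * (bpsk Es (block h c l m) - bpsk Es (block h c' l m)) / N0) * zl m -
      (α l * (bpsk Es (block h c l m) - bpsk Es (block h c' l m))) ^ 2 / (2 * N0))))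
      (fun l => by fun_prop)]
  refine Finset.prod_congr rfl fun l _ => ?_
  rw [lintegral_pi_fin_prod _
    (fun m x => ENNReal.ofReal (Real.exp
      (-(α l * (bpsk Es (block h c l m) - bpsk Es (block h c' l m)) / N0) * x -
      (α l * (bpsk Es (block h c l m) - bpsk Es (block h c' l m))) ^ 2 / (2 * N0))))
      (fun m => by fun_prop)]
  simp only [lintegral_exp_gaussianReal]
  rw [← ENNReal.ofReal_prod_of_nonneg fun _ _ => Real.exp_nonneg _, ← Real.exp_sum]
  congr 2
  -- With variance `N0 / 2` the Gaussian mean contributes `δ² / (4 N0)` against `-δ² / (2 N0)`;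
  -- antipodal symbols that differ have squared distance `4 Es`.
  calc _ = ∑ m, -(α l ^ 2 / (4 * N0)) *
        (bpsk Es (block h c l m) - bpsk Es (block h c' l m)) ^ 2 := by
        refine Finset.sum_congr rfl fun m _ => ?_
        rw [Real.coe_toNNReal _ (by positivity)]
        field_simp
        ring
    _ = _ := by
        rw [← Finset.mul_sum, sum_sq_bpsk_sub h hEs]
        field_simp

theorem lintegral_exp_rayleigh {s : ℝ} (hs : 0 ≤ s) :
    ∫⁻ a, ENNReal.ofReal (Real.exp (-s * a ^ 2)) ∂(rayleigh √(1 / 2)) =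
      ENNReal.ofReal (1 / (s + 1)) := by
  have hσ : √(1 / 2 : ℝ) ^ 2 = 1 / 2 := Real.sq_sqrt (by norm_num)
  have hmeas : Measurable fun a : ℝ => ENNReal.ofReal
      (if 0 ≤ a then a / √(1 / 2) ^ 2 * Real.exp (-a ^ 2 / (2 * √(1 / 2) ^ 2)) else 0) :=
    ENNReal.measurable_ofReal.comp
      (Measurable.ite measurableSet_Ici (by fun_prop) measurable_const)
  have hpos : (0 : ℝ) < s + 1 := by linarith
  rw [rayleigh, lintegral_withDensity_eq_lintegral_mul _ hmeas (by fun_prop)]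
  -- The Rayleigh density vanishes at 0, so the half-line may be taken open.
  have hfun : (fun a : ℝ => ENNReal.ofReal
        (if 0 ≤ a then a / √(1 / 2) ^ 2 * Real.exp (-a ^ 2 / (2 * √(1 / 2) ^ 2)) else 0)) *
      (fun a => ENNReal.ofReal (Real.exp (-s * a ^ 2))) =
      (Set.Ioi 0).indicator fun a => ENNReal.ofReal
        (2 * (a * Real.exp (-(s + 1) * a ^ 2))) := by
    funext a
    simp only [Pi.mul_apply, hσ]
    rcases lt_trichotomy a 0 with ha | rfl | ha
    · simp [ha.not_ge, ha.le]
    · simp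
    · rw [if_pos ha.le, Set.indicator_of_mem (Set.mem_Ioi.2 ha),
        ← ENNReal.ofReal_mul (by positivity), mul_assoc, ← Real.exp_add]
      congr 1
      rw [show -a ^ 2 / (2 * (1 / 2)) + -s * a ^ 2 = -(s + 1) * a ^ 2 by ring]
      ring
  rw [hfun, lintegral_indicator measurableSet_Ioi,
    ← ofReal_integral_eq_lintegral_ofReal
      (((integrable_mul_exp_neg_mul_sq hpos).integrableOn).const_mul 2)
      ((ae_restrict_iff' measurableSet_Ioi).2 (Filter.Eventually.of_forall fun a ha => by
        have : (0 : ℝ) < a := ha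
        show (0 : ℝ) ≤ _
        positivity)), integral_const_mul]
  congr 1
  have hint := integral_rpow_mul_exp_neg_mul_rpow (p := 2) (q := 1) (b := s + 1)
    (by norm_num) (by norm_num) hpos
  simp only [Real.rpow_one, Real.rpow_two] at hint
  rw [hint]
  norm_num [Real.rpow_neg_one]
  ring

theorem lintegral_sqrtRatio {n L M : ℕ} (h : L * M = 2 ^ n) {Es N0 : ℝ} (hEs : 0 ≤ Es)
    (hN0 : 0 < N0) (c c' : Fin (2 ^ n) → ZMod 2) :
    ∫⁻ ω, ENNReal.ofReal (sqrtRatio h Es N0 c c' ω.1 ω.2) ∂(fadingNoise L M N0) =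
      ENNReal.ofReal (fadingFactor h (Es / N0) (c' - c)) := by
  rw [fadingNoise, lintegral_prod _ (measurable_sqrtRatio h Es N0 c c').ennreal_ofReal.aemeasurable]
  simp only [lintegral_noise_sqrtRatio h hEs hN0]
  rw [lintegral_pi_fin_prod _ (fun l a => ENNReal.ofReal
    (Real.exp (-(hammingNorm (block h (c' - c) l) * (Es / N0)) * a ^ 2)))
    (fun l => by fun_prop), fadingFactor,
    ENNReal.ofReal_prod_of_nonneg fun _ _ => by positivity]
  exact Finset.prod_congr rfl fun l _ => lintegral_exp_rayleigh (by positivity)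

/-! ### The union bound -/

open Classical in
/-- The conditional error probability given the source block is at most the union bound. -/
theorem errorProb_given_source_le {n L M : ℕ} (h : L * M = 2 ^ n) {Es N0 : ℝ} (hEs : 0 ≤ Es)
    (hN0 : 0 < N0) (i : Fin (2 ^ n)) (u : Fin (2 ^ n) → ZMod 2) :
    (fadingNoise L M N0).real
      {ω | mlDecision h Es N0 i (received h Es (encode n u) ω.1 ω.2) (fun j => u j) ω.1 ≠ u i} ≤
      ∑ c : Fin (2 ^ n) → ZMod 2 with c ∈ polarSubcode n i, fadingFactor h (Es / N0) c := by
  have hr : 0 ≤ Es / N0 := by positivity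
  rw [← sum_competitors i u, measureReal_def]
  refine ENNReal.toReal_le_of_le_ofReal
    (Finset.sum_nonneg fun _ _ => fadingFactor_nonneg h hr _) ?_
  set f : (Fin L → ℝ) × (Fin L → Fin M → ℝ) → ENNReal := fun ω =>
    ∑ w ∈ competitors i u, ENNReal.ofReal (sqrtRatio h Es N0 (encode n u) (encode n w) ω.1 ω.2)
  have hmeas : ∀ w ∈ competitors i u, Measurable fun ω : (Fin L → ℝ) × (Fin L → Fin M → ℝ) =>
      ENNReal.ofReal (sqrtRatio h Es N0 (encode n u) (encode n w) ω.1 ω.2) :=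
    fun w _ => (measurable_sqrtRatio h Es N0 _ _).ennreal_ofReal
  calc fadingNoise L M N0 {ω | mlDecision h Es N0 i (received h Es (encode n u) ω.1 ω.2)
          (fun j => u j) ω.1 ≠ u i}
      ≤ fadingNoise L M N0 {ω | 1 ≤ f ω} := by
        -- Monotonicity needs no measurability of the error event; Markov's inequality is applied to
        -- the measurable `f`.
        refine measure_mono fun ω hω => ?_
        have h1 := one_le_sum_sqrtRatio h Es hN0 i u ω.1 ω.2 hω
        show 1 ≤ f ω
        simp only [f]
        rw [← ENNReal.ofReal_sum_of_nonneg fun w _ => (sqrtRatio_pos h Es N0 _ _ _ _).le]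
        simpa using ENNReal.ofReal_le_ofReal h1
    _ ≤ ∫⁻ ω, f ω ∂(fadingNoise L M N0) := by
        simpa using mul_meas_ge_le_lintegral (μ := fadingNoise L M N0)
          (Finset.measurable_fun_sum _ hmeas) 1
    _ = _ := by
        rw [lintegral_finsetSum _ hmeas,
          ENNReal.ofReal_sum_of_nonneg fun _ _ => fadingFactor_nonneg h hr _]
        simp only [lintegral_sqrtRatio h hEs hN0]

end PolarFading

theorem corollary1 (n L M : ℕ) (hLM : L * M = 2 ^ n) (i : Fin (2 ^ n))
    (Es N0 : ℝ) (hEs : 0 < Es) (hN0 : 0 < N0) :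
    PolarFading.polarizedErrorProb hLM Es N0 i ≤
      ∑ d ∈ Fintype.piFinset (fun _ : Fin L => Finset.Icc 0 M) with
          PolarFading.minDist n i ≤ ∑ l, d l ∧ ∑ l, d l ≤ 2 ^ n,
        (PolarFading.splitEnumerator hLM i d : ℝ) *
          ∏ l, 1 / ((d l : ℝ) * (Es / N0) + 1) := by
  classical
  have hle : ∀ u : Fin (2 ^ n) → ZMod 2, _ :=
    PolarFading.errorProb_given_source_le hLM hEs.le hN0 i
  rw [← PolarFading.sum_fadingFactor_eq, PolarFading.polarizedErrorProb]
  -- The bound is the same for all `2 ^ N` source blocks, `N = 2 ^ n`, so the uniform average leaves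
  -- it unchanged.
  refine (mul_le_mul_of_nonneg_left (Finset.sum_le_card_nsmul _ _ _ fun u _ => hle u)
    (by positivity)).trans_eq ?_
  simp
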